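/- Let $a<0$, $b>0$, $\gamma>0$, $\ell<0$ and $\bar r\neq 0$ be real constants, and consider the scalar closed-loop reference model (CRM) adaptive system with constant reference input $\bar r$, with state $z=[x_m,e,\phi]^{\mathsf T}\in\mathbb R^3$ and plant state $x=e+x_m$: $$\dot x_m = a x_m + b\bar r-\ell e,\qquad \dot e=(a+\ell)e+b\,\phi\,x,\qquad \dot\phi=-\gamma\, e\,x .$$ Put $\bar x=-b\bar r/a$ and $\bar z=[\bar x,0,0]^{\mathsf T}$. Then $\bar z$ is the unique equilibrium of the system; for every $t_0\ge 0$ and $z_0\in\mathbb R^3$ there is a solution $t\mapsto s(t;z_0,t_0)$ on $[t_0,\infty)$ with $s(t_0;z_0,t_0)=z_0$; and $\bar z$ is uniformly asymptotically stable in the large (UASL). That is, for every choice of such solutions $s$, with $\|\cdot\|$ the Euclidean norm: (i) (uniformly stable) for every $\epsilon>0$ there is $\delta>0$ such that for all $t_0\ge0$ and all $z_0$, $\|z_0-\bar z\|\le\delta$ implies $\|s(t;z_0,t_0)-\bar z\|\le\epsilon$ for all $t\ge t_0$; (ii) (uniformly bounded) for every $R>0$ there is $B$ such that for all $t_0\ge0$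 and all $z_0$, $\|z_0-\bar z\|\le R$ implies $\|s(t;z_0,t_0)-\bar z\|\le B$ for all $t\ge t_0$; (iii) (uniformly attracting in the large) for all $\rho>0$ and $\eta>0$ there is $T\ge 0$ such that for all $t_0\ge0$ and all $z_0$, $\|z_0-\bar z\|\le\rho$ implies $\|s(t;z_0,t_0)-\bar z\|\le\eta$ for all $t\ge t_0+T$. -/

import Mathlib

noncomputable section

namespace CRMStability

variable {E : Type*} [NormedAddCommGroup E]

/-- `s t x₀ t₀` is a transition function of `ẋ(t) = f (x(t), t)`: for every initial time `t₀ ≥ 0` and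
every initial state `x₀`, the map `t ↦ s t x₀ t₀` solves the equation on all of `[t₀, ∞)` (with the
one-sided derivative at `t₀`) and equals `x₀` at time `t₀`. -/
def IsTransitionFunction [NormedSpace ℝ E] (f : E → ℝ → E) (s : ℝ → E → ℝ → E) : Prop :=
  ∀ t₀ : ℝ, 0 ≤ t₀ → ∀ x₀ : E, s t₀ x₀ t₀ = x₀ ∧
    ∀ t : ℝ, t₀ ≤ t →
      HasDerivWithinAt (fun τ => s τ x₀ t₀) (f (s t x₀ t₀) t) (Set.Ici t₀) t

/-- The state `p` is an equilibrium of `ẋ(t) = f (x(t), t)`. -/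
def IsEquilibrium (f : E → ℝ → E) (p : E) : Prop :=
  ∀ t : ℝ, 0 ≤ t → f p t = 0

/-- Uniform stability of `p`: `δ` depends only on `ε`. -/
def UniformlyStable (s : ℝ → E → ℝ → E) (p : E) : Prop :=
  ∀ ε : ℝ, 0 < ε → ∃ δ : ℝ, 0 < δ ∧
    ∀ t₀ : ℝ, 0 ≤ t₀ → ∀ x₀ : E, ‖x₀ - p‖ ≤ δ →
      ∀ t : ℝ, t₀ ≤ t → ‖s t x₀ t₀ - p‖ ≤ ε

/-- Uniform boundedness relative to `p`: `B` depends only on `r`. -/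
def UniformlyBounded (s : ℝ → E → ℝ → E) (p : E) : Prop :=
  ∀ r : ℝ, 0 < r → ∃ B : ℝ,
    ∀ t₀ : ℝ, 0 ≤ t₀ → ∀ x₀ : E, ‖x₀ - p‖ ≤ r →
      ∀ t : ℝ, t₀ ≤ t → ‖s t x₀ t₀ - p‖ ≤ B

/-- Uniform attraction in the large of `p`: `T` depends only on `ρ` and `η`. -/
def UniformlyAttractingInTheLarge (s : ℝ → E → ℝ → E) (p : E) : Prop :=
  ∀ ρ : ℝ, 0 < ρ → ∀ η : ℝ, 0 < η → ∃ T : ℝ, 0 ≤ T ∧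
    ∀ t₀ : ℝ, 0 ≤ t₀ → ∀ x₀ : E, ‖x₀ - p‖ ≤ ρ →
      ∀ t : ℝ, t₀ + T ≤ t → ‖s t x₀ t₀ - p‖ ≤ η

/-- Uniform asymptotic stability in the large (UASL) of `p`. -/
def UASL (s : ℝ → E → ℝ → E) (p : E) : Prop :=
  UniformlyStable s p ∧ UniformlyBounded s p ∧ UniformlyAttractingInTheLarge s p

/-- Right-hand side of the scalar closed-loop reference model (CRM) adaptive system with constant
reference input `r`; the state is `z = [x_m, e, φ]`, and the plant state is `x = e + x_m`. -/
def crmField (a b γ r ℓ : ℝ) (z : EuclideanSpace ℝ (Fin 3)) (_t : ℝ) :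
    EuclideanSpace ℝ (Fin 3) :=
  !₂[a * z 0 + b * r - ℓ * z 1,
     (a + ℓ) * z 1 + b * z 2 * (z 1 + z 0),
     -γ * z 1 * (z 1 + z 0)]

/-- The state `[x̄, 0, 0]` with `x̄ = -b r / a`. -/
def crmEquilibrium (a b r : ℝ) : EuclideanSpace ℝ (Fin 3) :=
  !₂[-b * r / a, 0, 0]

end CRMStability

end

/-!
The quadratic form `V = a (a + ℓ) (x_m - x̄)² + (a² + ℓ²) (e² + (b / γ) φ²)` satisfies
`V' ≤ (a + ℓ) a² ((x_m - x̄)² + e²)` along the system: the weights make the indefinite cross terms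
in `φ` cancel and turn that in `(x_m - x̄) e` into part of a square. This bounds all trajectories,
hence also yields their global existence, but says nothing about `φ`. Excitation comes from the
constant reference: since `x̄ ≠ 0`, the derivative of `b x̄ e φ` contains `(b x̄ φ)²`, and on a ball
the remaining terms are dominated by a small multiple of that one and a large multiple of
`(x_m - x̄)² + e²`. So `N V - b x̄ e φ` with `N` large is a strict Lyapunov function on that ball,
and trajectories converge exponentially, at a rate depending only on the ball.
-/

namespace CRMStability

open Set Metric Filter Topology
open scoped Manifold

section IntegralCurves

variable {E : Type*} [NormedAddCommGroup E] [NormedSpace ℝ E]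

theorem le_mul_exp_of_deriv_le_mul {u u' : ℝ → ℝ} {t₀ K : ℝ}
    (hu : ∀ t ∈ Ici t₀, HasDerivWithinAt u (u' t) (Ici t₀) t)
    (hK : ∀ t ∈ Ici t₀, u' t ≤ K * u t) {t : ℝ} (ht : t₀ ≤ t) :
    u t ≤ u t₀ * Real.exp (K * (t - t₀)) := by
  rw [← gronwallBound_ε0]
  refine le_gronwallBound_of_liminf_deriv_right_le (f' := u') (b := t)
    (fun τ hτ => (hu τ hτ.1).continuousWithinAt.mono Icc_subset_Ici_self)
    (fun τ hτ _ hlt => ?_) le_rfl (fun τ hτ => by simpa using hK τ hτ.1) t ⟨ht, le_rfl⟩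
  exact ((hu τ hτ.1).mono (Ici_subset_Ici.2 hτ.1)).liminf_right_slope_le hlt

theorem le_mul_exp_of_fderiv_le_mul {V : E → ℝ} (hV : Differentiable ℝ V) {v : ℝ → E → E}
    {z : ℝ → E} {t₀ K : ℝ} (hz : IsIntegralCurveOn z v (Ici t₀))
    (hK : ∀ t ∈ Ici t₀, fderiv ℝ V (z t) (v t (z t)) ≤ K * V (z t)) {t : ℝ} (ht : t₀ ≤ t) :
    V (z t) ≤ V (z t₀) * Real.exp (K * (t - t₀)) :=
  le_mul_exp_of_deriv_le_mul (u := V ∘ z)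
    (fun τ hτ => (hV (z τ)).hasFDerivAt.comp_hasDerivWithinAt τ (hz τ hτ)) hK ht

theorem exists_isIntegralCurve_of_hasCompactSupport [CompleteSpace E] {f : E → E}
    (hf : ContDiff ℝ 1 f) (hsupp : HasCompactSupport f) (t₀ : ℝ) (x₀ : E) :
    ∃ z : ℝ → E, z t₀ = x₀ ∧ IsIntegralCurve z (fun _ => f) := by
  obtain ⟨K, hK⟩ := hf.lipschitzWith_of_hasCompactSupport hsupp one_ne_zero
  obtain ⟨L, hL⟩ := hsupp.exists_bound_of_continuous hf.continuous
  have local_solution (x : E) : ∃ z : ℝ → E, z 0 = x ∧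
      IsMIntegralCurveOn (I := 𝓘(ℝ, E)) z f (Ioo (-1) 1) := by
    have hPL : IsPicardLindelof (fun _ => f) (⟨0, by simp⟩ : Icc (-1 : ℝ) 1) x L.toNNReal 0
        L.toNNReal K :=
      .of_time_independent (fun y _ => (hL y).trans (Real.le_coe_toNNReal L)) hK.lipschitzOnWith
        (by simp)
    obtain ⟨z, hz₀, hz⟩ := hPL.exists_eq_forall_mem_Icc_hasDerivWithinAt₀
    refine ⟨z, hz₀, fun t ht => HasFDerivWithinAt.hasMFDerivWithinAt ?_⟩
    exact ((hz t (Ioo_subset_Icc_self ht)).mono Ioo_subset_Icc_self).hasFDerivWithinAt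
  obtain ⟨z, hz₀, hz⟩ := exists_isMIntegralCurve_of_isMIntegralCurveOn (I := 𝓘(ℝ, E)) (v := f)
    (contMDiff_vectorSpace_iff_contDiff.2 hf) one_pos local_solution x₀
  have hcurve : IsIntegralCurve z (fun _ => f) := fun t =>
    (hasMFDerivAt_iff_hasFDerivAt.1 (hz t) : HasFDerivAt z _ t)
  exact ⟨z ∘ (· - t₀), by simpa using hz₀, hcurve.comp_sub t₀⟩

theorem exists_isIntegralCurveOn_Ici_of_fderiv_nonpos [FiniteDimensional ℝ E] {f : E → E}
    (hf : ContDiff ℝ 1 f) {V : E → ℝ} (hV : Differentiable ℝ V)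
    (hVf : ∀ x, fderiv ℝ V x (f x) ≤ 0) (hbdd : ∀ c, Bornology.IsBounded {x | V x ≤ c})
    (t₀ : ℝ) (x₀ : E) :
    ∃ z : ℝ → E, z t₀ = x₀ ∧ IsIntegralCurveOn z (fun _ => f) (Ici t₀) := by
  have := FiniteDimensional.complete ℝ E
  obtain ⟨R, hR, hsub⟩ := (hbdd (V x₀)).subset_closedBall_lt 0 0
  -- Cutting `f` off outside a ball containing the sublevel set of `x₀` does not affect the
  -- trajectory from `x₀`, since `V` is nonincreasing along the cut-off field too.
  let χ : ContDiffBump (0 : E) := ⟨R, R + 1, hR, by linarith⟩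
  obtain ⟨z, hz₀, hz⟩ := exists_isIntegralCurve_of_hasCompactSupport (f := fun x => χ x • f x)
    (χ.contDiff.smul hf) χ.hasCompactSupport.smul_right t₀ x₀
  have hVz (t : ℝ) (ht : t ∈ Ici t₀) : V (z t) ≤ V x₀ := by
    simpa [hz₀] using le_mul_exp_of_fderiv_le_mul (K := 0) hV (hz.isIntegralCurveOn _)
      (fun τ _ => by simpa using mul_nonpos_of_nonneg_of_nonpos χ.nonneg (hVf (z τ))) ht
  refine ⟨z, hz₀, fun t ht => ?_⟩
  simpa [χ.one_of_mem_closedBall (hsub (hVz t ht))] using (hz t).hasDerivWithinAt (s := Ici t₀)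

end IntegralCurves

section LyapunovCandidates

variable {E : Type*} [NormedAddCommGroup E] [NormedSpace ℝ E] {V : E → ℝ} {p : E}

/-- `V` is a candidate Lyapunov function of quadratic type for the state `p`: it is differentiable
and lies between two positive multiples of the squared distance to `p`. Its decrease along a vector
field `f` is expressed separately, through the orbital derivative `fderiv ℝ V x (f x)`. -/
structure IsLyapunovCandidate (V : E → ℝ) (p : E) : Prop where
  differentiable : Differentiable ℝ V
  exists_bounds : ∃ c > 0, ∃ C > 0, ∀ x, c * ‖x - p‖ ^ 2 ≤ V x ∧ V x ≤ C * ‖x - p‖ ^ 2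

namespace IsLyapunovCandidate

theorem isBounded_sublevel (hV : IsLyapunovCandidate V p) (c : ℝ) :
    Bornology.IsBounded {x | V x ≤ c} := by
  obtain ⟨c₁, hc₁, _, _, hbounds⟩ := hV.exists_bounds
  refine (isBounded_closedBall (x := p) (r := √(c / c₁))).subset fun x hx => ?_
  rw [mem_closedBall_iff_norm]
  exact Real.le_sqrt_of_sq_le ((le_div_iff₀' hc₁).2 ((hbounds x).1.trans hx))

theorem exists_norm_sub_le_mul_exp (hV : IsLyapunovCandidate V p) :
    ∃ C > 0, ∀ {v : ℝ → E → E} {z : ℝ → E} {t₀ κ : ℝ}, IsIntegralCurveOn z v (Ici t₀) →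
      (∀ t ∈ Ici t₀, fderiv ℝ V (z t) (v t (z t)) ≤ -(2 * κ) * V (z t)) →
      ∀ t ∈ Ici t₀, ‖z t - p‖ ≤ C * Real.exp (-κ * (t - t₀)) * ‖z t₀ - p‖ := by
  obtain ⟨c₁, hc₁, c₂, hc₂, hbounds⟩ := hV.exists_bounds
  refine ⟨√(c₂ / c₁), by positivity, fun {v z t₀ κ} hz hκ t ht => ?_⟩
  refine le_of_sq_le_sq ?_ (by positivity)
  rw [mul_pow, mul_pow, Real.sq_sqrt (by positivity), ← Real.exp_nat_mul, div_mul_eq_mul_div,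
    div_mul_eq_mul_div, le_div_iff₀' hc₁]
  calc c₁ * ‖z t - p‖ ^ 2 ≤ V (z t) := (hbounds _).1
    _ ≤ V (z t₀) * Real.exp (-(2 * κ) * (t - t₀)) :=
      le_mul_exp_of_fderiv_le_mul hV.differentiable hz hκ ht
    _ ≤ c₂ * ‖z t₀ - p‖ ^ 2 * Real.exp (-(2 * κ) * (t - t₀)) := by
      gcongr
      exact (hbounds _).2
    _ = c₂ * Real.exp (↑2 * (-κ * (t - t₀))) * ‖z t₀ - p‖ ^ 2 := by ring_nf

theorem exists_strict (hV : IsLyapunovCandidate V p) {Y : E → ℝ} (hY : Differentiable ℝ Y)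
    {M : ℝ} (hYM : ∀ x, |Y x| ≤ M * ‖x - p‖ ^ 2) {f : E → E} {S : Set E} {q : E → ℝ}
    {m d K : ℝ} (hm : 0 < m) (hd : 0 < d) (hq : ∀ x ∈ S, 0 ≤ q x)
    (hVf : ∀ x ∈ S, fderiv ℝ V x (f x) ≤ -(d * q x))
    (hYf : ∀ x ∈ S, m * ‖x - p‖ ^ 2 - K * q x ≤ fderiv ℝ Y x (f x)) :
    ∃ W, IsLyapunovCandidate W p ∧ ∃ κ > 0, ∀ x ∈ S, fderiv ℝ W x (f x) ≤ -κ * W x := by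
  obtain ⟨c₁, hc₁, c₂, hc₂, hbounds⟩ := hV.exists_bounds
  obtain ⟨N, hN, hKN, hMN⟩ : ∃ N > 0, K ≤ N * d ∧ M + 1 ≤ N * c₁ :=
    ⟨max 1 (max (K / d) ((M + 1) / c₁)), by positivity,
      (div_le_iff₀ hd).1 ((le_max_left _ _).trans (le_max_right _ _)),
      (div_le_iff₀ hc₁).1 ((le_max_right _ _).trans (le_max_right _ _))⟩
  have hupper (x : E) : N * V x - Y x ≤ (N * c₂ + |M|) * ‖x - p‖ ^ 2 :=
    calc N * V x - Y x ≤ N * (c₂ * ‖x - p‖ ^ 2) + |M| * ‖x - p‖ ^ 2 := by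
          rw [sub_eq_add_neg]
          gcongr
          · exact (hbounds x).2
          · exact (neg_le_abs _).trans ((hYM x).trans (by gcongr; exact le_abs_self M))
      _ = (N * c₂ + |M|) * ‖x - p‖ ^ 2 := by ring
  have hlower (x : E) : 1 * ‖x - p‖ ^ 2 ≤ N * V x - Y x :=
    calc 1 * ‖x - p‖ ^ 2 = (M + 1) * ‖x - p‖ ^ 2 - M * ‖x - p‖ ^ 2 := by ring
      _ ≤ N * c₁ * ‖x - p‖ ^ 2 - Y x := by
          gcongr
          exact (le_abs_self _).trans (hYM x)
      _ = N * (c₁ * ‖x - p‖ ^ 2) - Y x := by ring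
      _ ≤ N * V x - Y x := by
          gcongr
          exact (hbounds x).1
  refine ⟨fun x => N * V x - Y x, ⟨(hV.differentiable.const_mul N).sub hY, 1, one_pos,
    N * c₂ + |M|, by positivity, fun x => ⟨hlower x, hupper x⟩⟩, m / (N * c₂ + |M|), by positivity,
    fun x hx => ?_⟩
  rw [fderiv_fun_sub ((hV.differentiable x).const_mul N) (hY x),
    fderiv_const_mul (hV.differentiable x)]
  calc N * fderiv ℝ V x (f x) - fderiv ℝ Y x (f x)
      ≤ N * -(d * q x) - (m * ‖x - p‖ ^ 2 - K * q x) := by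
        gcongr
        exacts [hVf x hx, hYf x hx]
    _ = -(m * ‖x - p‖ ^ 2) - (N * d - K) * q x := by ring
    _ ≤ -(m * ‖x - p‖ ^ 2) := sub_le_self _ (mul_nonneg (sub_nonneg.2 hKN) (hq x hx))
    _ = -(m / (N * c₂ + |M|)) * ((N * c₂ + |M|) * ‖x - p‖ ^ 2) := by field_simp
    _ ≤ -(m / (N * c₂ + |M|)) * (N * V x - Y x) :=
        mul_le_mul_of_nonpos_left (hupper x) (neg_nonpos.2 (by positivity))

end IsLyapunovCandidate

end LyapunovCandidates

section Stability

variable {E : Type*} [NormedAddCommGroup E] {s : ℝ → E → ℝ → E} {p : E}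

theorem uniformlyStable_of_norm_sub_le {C : ℝ} (hC : 0 < C)
    (hs : ∀ t₀, 0 ≤ t₀ → ∀ x₀ t, t₀ ≤ t → ‖s t x₀ t₀ - p‖ ≤ C * ‖x₀ - p‖) : UniformlyStable s p :=
  fun ε hε => ⟨ε / C, div_pos hε hC, fun t₀ ht₀ x₀ hx₀ t ht =>
    (hs t₀ ht₀ x₀ t ht).trans ((le_div_iff₀' hC).1 hx₀)⟩

theorem uniformlyBounded_of_norm_sub_le {C : ℝ} (hC : 0 ≤ C)
    (hs : ∀ t₀, 0 ≤ t₀ → ∀ x₀ t, t₀ ≤ t → ‖s t x₀ t₀ - p‖ ≤ C * ‖x₀ - p‖) : UniformlyBounded s p :=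
  fun R _ => ⟨C * R, fun t₀ ht₀ x₀ hx₀ t ht =>
    (hs t₀ ht₀ x₀ t ht).trans (mul_le_mul_of_nonneg_left hx₀ hC)⟩

theorem uniformlyAttractingInTheLarge_of_norm_sub_le_mul_exp
    (hs : ∀ ρ > 0, ∃ C > 0, ∃ κ > 0, ∀ t₀, 0 ≤ t₀ → ∀ x₀, ‖x₀ - p‖ ≤ ρ → ∀ t, t₀ ≤ t →
      ‖s t x₀ t₀ - p‖ ≤ C * Real.exp (-κ * (t - t₀)) * ‖x₀ - p‖) :
    UniformlyAttractingInTheLarge s p := by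
  intro ρ hρ η hη
  obtain ⟨C, hC, κ, hκ, hexp⟩ := hs ρ hρ
  have hlim : Tendsto (fun t : ℝ => C * Real.exp (-κ * t) * ρ) atTop (𝓝 0) := by
    have := Real.tendsto_exp_atBot.comp (tendsto_id.const_mul_atTop_of_neg (neg_neg_of_pos hκ))
    simpa using (this.const_mul C).mul_const ρ
  obtain ⟨T, hT⟩ := eventually_atTop.1 (hlim.eventually_le_const hη)
  refine ⟨max T 0, le_max_right _ _, fun t₀ ht₀ x₀ hx₀ t ht => ?_⟩
  have hTt : T ≤ t - t₀ := (le_max_left T 0).trans (by linarith)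
  have ht₀t : t₀ ≤ t := (le_add_of_nonneg_right (le_max_right T 0)).trans ht
  calc ‖s t x₀ t₀ - p‖ ≤ C * Real.exp (-κ * (t - t₀)) * ‖x₀ - p‖ := hexp t₀ ht₀ x₀ hx₀ t ht₀t
    _ ≤ C * Real.exp (-κ * (t - t₀)) * ρ := by gcongr
    _ ≤ η := hT _ hTt

variable [NormedSpace ℝ E] {f : E → ℝ → E} {V : E → ℝ}

theorem IsTransitionFunction.isIntegralCurveOn (hs : IsTransitionFunction f s) {t₀ : ℝ}
    (ht₀ : 0 ≤ t₀) (x₀ : E) :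
    IsIntegralCurveOn (fun t => s t x₀ t₀) (fun t x => f x t) (Ici t₀) :=
  (hs t₀ ht₀ x₀).2

theorem IsTransitionFunction.exists_norm_sub_le (hs : IsTransitionFunction f s)
    (hV : IsLyapunovCandidate V p) (hVf : ∀ t, 0 ≤ t → ∀ x, fderiv ℝ V x (f x t) ≤ 0) :
    ∃ C > 0, ∀ t₀, 0 ≤ t₀ → ∀ x₀ t, t₀ ≤ t → ‖s t x₀ t₀ - p‖ ≤ C * ‖x₀ - p‖ := by
  obtain ⟨C, hC, hexp⟩ := hV.exists_norm_sub_le_mul_exp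
  refine ⟨C, hC, fun t₀ ht₀ x₀ t ht => ?_⟩
  simpa [(hs t₀ ht₀ x₀).1] using hexp (κ := 0) (hs.isIntegralCurveOn ht₀ x₀)
    (fun τ hτ => by simpa using hVf τ (ht₀.trans hτ) _) t ht

theorem IsTransitionFunction.uasl_of_lyapunov (hs : IsTransitionFunction f s)
    (hV : IsLyapunovCandidate V p) (hVf : ∀ t, 0 ≤ t → ∀ x, fderiv ℝ V x (f x t) ≤ 0)
    (hstrict : ∀ R, ∃ W, IsLyapunovCandidate W p ∧ ∃ κ > 0,
      ∀ t, 0 ≤ t → ∀ x ∈ closedBall p R, fderiv ℝ W x (f x t) ≤ -κ * W x) :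
    UASL s p := by
  obtain ⟨B, hB, hnorm⟩ := hs.exists_norm_sub_le hV hVf
  refine ⟨uniformlyStable_of_norm_sub_le hB hnorm, uniformlyBounded_of_norm_sub_le hB.le hnorm,
    uniformlyAttractingInTheLarge_of_norm_sub_le_mul_exp fun ρ _ => ?_⟩
  obtain ⟨W, hW, κ, hκ, hWf⟩ := hstrict (B * ρ)
  obtain ⟨C, hC, hexp⟩ := hW.exists_norm_sub_le_mul_exp
  refine ⟨C, hC, κ / 2, by positivity, fun t₀ ht₀ x₀ hx₀ t ht => ?_⟩
  have hball (τ : ℝ) (hτ : t₀ ≤ τ) : s τ x₀ t₀ ∈ closedBall p (B * ρ) :=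
    mem_closedBall_iff_norm.2 ((hnorm t₀ ht₀ x₀ τ hτ).trans (by gcongr))
  have hWs (τ : ℝ) (hτ : τ ∈ Ici t₀) :
      fderiv ℝ W (s τ x₀ t₀) (f (s τ x₀ t₀) τ) ≤ -(2 * (κ / 2)) * W (s τ x₀ t₀) := by
    rw [mul_div_cancel₀ κ two_ne_zero]
    exact hWf τ (ht₀.trans hτ) _ (hball τ hτ)
  simpa only [(hs t₀ ht₀ x₀).1] using hexp (hs.isIntegralCurveOn ht₀ x₀) hWs t ht

end Stability

section WeightedSqDist

variable {ι : Type*} [Fintype ι]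

/-- The squared distance between `p` and `x` in Euclidean space, with the coordinates weighted by
`w`; the diagonal quadratic forms among the candidate Lyapunov functions. -/
def weightedSqDist (w : ι → ℝ) (p x : EuclideanSpace ℝ ι) : ℝ :=
  ∑ i, w i * (x i - p i) ^ 2

theorem hasFDerivAt_weightedSqDist (w : ι → ℝ) (p x : EuclideanSpace ℝ ι) :
    HasFDerivAt (weightedSqDist w p)
      (∑ i, (2 * w i * (x i - p i)) • (EuclideanSpace.proj i : EuclideanSpace ℝ ι →L[ℝ] ℝ)) x := by
  refine HasFDerivAt.fun_sum fun i _ => ?_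
  have hcoord := (EuclideanSpace.proj i : EuclideanSpace ℝ ι →L[ℝ] ℝ).hasFDerivAt (x := x)
  refine (((hcoord.sub_const (p i)).pow 2).const_mul (w i)).congr_fderiv ?_
  ext v
  simp only [PiLp.proj_apply, Nat.add_one_sub_one, pow_one, nsmul_eq_mul, Nat.cast_ofNat,
    smul_apply, smul_eq_mul]
  ring

theorem fderiv_weightedSqDist_apply (w : ι → ℝ) (p x v : EuclideanSpace ℝ ι) :
    fderiv ℝ (weightedSqDist w p) x v = ∑ i, 2 * w i * (x i - p i) * v i := by
  simp [(hasFDerivAt_weightedSqDist w p x).fderiv, sum_apply]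

theorem isLyapunovCandidate_weightedSqDist {w : ι → ℝ} (hw : ∀ i, 0 < w i)
    (p : EuclideanSpace ℝ ι) : IsLyapunovCandidate (weightedSqDist w p) p := by
  refine ⟨fun x => (hasFDerivAt_weightedSqDist w p x).differentiableAt, ?_⟩
  obtain ⟨c, hc, hcw⟩ : ∃ c > 0, ∀ i, c ≤ w i := by
    obtain ⟨M, hM⟩ := Finite.exists_le fun i => (w i)⁻¹
    exact ⟨(max M 1)⁻¹, by positivity, fun i =>
      inv_le_of_inv_le₀ (hw i) ((hM i).trans (le_max_left M 1))⟩
  obtain ⟨C, hC⟩ := Finite.exists_le w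
  refine ⟨c, hc, max C 1, by positivity, fun x => ?_⟩
  simp only [EuclideanSpace.real_norm_sq_eq, PiLp.sub_apply, Finset.mul_sum, weightedSqDist]
  constructor <;> gcongr with i
  exacts [hcw i, (hC i).trans (le_max_left C 1)]

end WeightedSqDist

section CRM

variable {a b γ r ℓ : ℝ}

theorem contDiff_crmField (a b γ r ℓ : ℝ) {n : WithTop ℕ∞} (t : ℝ) :
    ContDiff ℝ n (fun z => crmField a b γ r ℓ z t) := by
  rw [contDiff_euclidean]
  intro i
  fin_cases i <;> simp only [crmField, Fin.zero_eta, Fin.mk_one, Fin.reduceFinMk,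
    Matrix.cons_val] <;> fun_prop

theorem mul_crmEquilibrium_zero (ha : a ≠ 0) (b r : ℝ) :
    a * crmEquilibrium a b r 0 = -(b * r) := by
  simp [crmEquilibrium, mul_div_cancel₀ _ ha]

theorem crmEquilibrium_zero_ne_zero (ha : a ≠ 0) (hb : b ≠ 0) (hr : r ≠ 0) :
    crmEquilibrium a b r 0 ≠ 0 := by
  simp [crmEquilibrium, ha, hb, hr]

theorem norm_sub_crmEquilibrium_sq (a b r : ℝ) (z : EuclideanSpace ℝ (Fin 3)) :
    ‖z - crmEquilibrium a b r‖ ^ 2 = (z 0 - crmEquilibrium a b r 0) ^ 2 + z 1 ^ 2 + z 2 ^ 2 := by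
  simp [EuclideanSpace.real_norm_sq_eq, Fin.sum_univ_three, crmEquilibrium]

theorem crmField_eq_zero_iff (ha : a ≠ 0) (haℓ : a + ℓ ≠ 0) (hb : b ≠ 0) (hγ : γ ≠ 0)
    (hr : r ≠ 0) (z : EuclideanSpace ℝ (Fin 3)) (t : ℝ) :
    crmField a b γ r ℓ z t = 0 ↔ z = crmEquilibrium a b r := by
  have hx := crmEquilibrium_zero_ne_zero ha hb hr
  constructor
  · intro hz
    have hm : a * z 0 + b * r - ℓ * z 1 = 0 := congrArg (· 0) hz
    have he : (a + ℓ) * z 1 + b * z 2 * (z 1 + z 0) = 0 := congrArg (· 1) hz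
    have hφ : -γ * z 1 * (z 1 + z 0) = 0 := congrArg (· 2) hz
    have h₁ : z 1 = 0 := by
      rcases mul_eq_zero.1 hφ with h | h
      · simpa [hγ] using h
      · simpa [h, haℓ] using he
    have h₀ : z 0 = crmEquilibrium a b r 0 := by
      apply mul_left_cancel₀ ha
      rw [mul_crmEquilibrium_zero ha]
      linear_combination hm + ℓ * h₁
    have h₂ : z 2 = 0 := by simpa [h₁, h₀, hb, hx] using he
    ext i
    fin_cases i
    exacts [h₀, h₁, h₂]
  · rintro rfl
    have hax := mul_crmEquilibrium_zero ha b r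
    ext i
    fin_cases i <;> simp_all [crmField, crmEquilibrium]

theorem isEquilibrium_crmField_iff (ha : a ≠ 0) (haℓ : a + ℓ ≠ 0) (hb : b ≠ 0) (hγ : γ ≠ 0)
    (hr : r ≠ 0) (p : EuclideanSpace ℝ (Fin 3)) :
    IsEquilibrium (crmField a b γ r ℓ) p ↔ p = crmEquilibrium a b r :=
  ⟨fun h => (crmField_eq_zero_iff ha haℓ hb hγ hr p 0).1 (h 0 le_rfl),
    fun h t _ => (crmField_eq_zero_iff ha haℓ hb hγ hr p t).2 h⟩

/-- A weak Lyapunov function of the CRM system: it is nonincreasing along trajectories, but its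
orbital derivative does not see `φ`. -/
noncomputable def crmLyapunov (a b γ r ℓ : ℝ) : EuclideanSpace ℝ (Fin 3) → ℝ :=
  weightedSqDist ![a * (a + ℓ), a ^ 2 + ℓ ^ 2, (a ^ 2 + ℓ ^ 2) * (b / γ)] (crmEquilibrium a b r)

theorem isLyapunovCandidate_crmLyapunov (ha : a < 0) (haℓ : a + ℓ < 0) (hbγ : 0 < b * γ) (r : ℝ) :
    IsLyapunovCandidate (crmLyapunov a b γ r ℓ) (crmEquilibrium a b r) := by
  have hx : 0 < a * (a + ℓ) := mul_pos_of_neg_of_neg ha haℓ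
  have he : 0 < a ^ 2 + ℓ ^ 2 := by have := sq_pos_of_neg ha; positivity
  have hφ : 0 < b / γ := div_pos_iff.2 (mul_pos_iff.1 hbγ)
  refine isLyapunovCandidate_weightedSqDist (fun i => ?_) _
  fin_cases i
  exacts [hx, he, mul_pos he hφ]

theorem fderiv_crmLyapunov_crmField (ha : a ≠ 0) (hγ : γ ≠ 0) (b r ℓ : ℝ)
    (z : EuclideanSpace ℝ (Fin 3)) (t : ℝ) :
    fderiv ℝ (crmLyapunov a b γ r ℓ) z (crmField a b γ r ℓ z t) =
      (a + ℓ) * ((a * (z 0 - crmEquilibrium a b r 0) - ℓ * z 1) ^ 2 +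
        a ^ 2 * (z 0 - crmEquilibrium a b r 0) ^ 2 + (2 * a ^ 2 + ℓ ^ 2) * z 1 ^ 2) := by
  have hbr := mul_crmEquilibrium_zero ha b r
  rw [crmLyapunov, fderiv_weightedSqDist_apply, Fin.sum_univ_three]
  generalize crmEquilibrium a b r 0 = x at hbr ⊢
  simp only [crmField, crmEquilibrium, Matrix.cons_val, sub_zero]
  field_simp
  linear_combination 2 * a * (a + ℓ) * (z 0 - x) * hbr

theorem fderiv_crmLyapunov_crmField_le (ha : a ≠ 0) (haℓ : a + ℓ ≤ 0) (hγ : γ ≠ 0) (b r : ℝ)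
    (z : EuclideanSpace ℝ (Fin 3)) (t : ℝ) :
    fderiv ℝ (crmLyapunov a b γ r ℓ) z (crmField a b γ r ℓ z t) ≤
      -(-(a + ℓ) * a ^ 2 * ((z 0 - crmEquilibrium a b r 0) ^ 2 + z 1 ^ 2)) := by
  rw [fderiv_crmLyapunov_crmField ha hγ]
  have hdrop : 0 ≤ -(a + ℓ) * ((a * (z 0 - crmEquilibrium a b r 0) - ℓ * z 1) ^ 2 +
      (a ^ 2 + ℓ ^ 2) * z 1 ^ 2) := by
    have := neg_nonneg.2 haℓ
    positivity
  linarith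

theorem fderiv_crmLyapunov_crmField_nonpos (ha : a ≠ 0) (haℓ : a + ℓ ≤ 0) (hγ : γ ≠ 0) (b r : ℝ)
    (z : EuclideanSpace ℝ (Fin 3)) (t : ℝ) :
    fderiv ℝ (crmLyapunov a b γ r ℓ) z (crmField a b γ r ℓ z t) ≤ 0 := by
  rw [fderiv_crmLyapunov_crmField ha hγ]
  exact mul_nonpos_of_nonpos_of_nonneg haℓ (by positivity)

/-- The correction that turns `crmLyapunov` into a strict Lyapunov function on balls: its orbital
derivative contains `(b x̄ φ)²`. -/
noncomputable def crmCross (a b r : ℝ) (z : EuclideanSpace ℝ (Fin 3)) : ℝ :=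
  b * crmEquilibrium a b r 0 * (z 1 * z 2)

theorem differentiable_crmCross (a b r : ℝ) : Differentiable ℝ (crmCross a b r) := by
  unfold crmCross
  fun_prop

theorem fderiv_crmCross_apply (a b r : ℝ) (z v : EuclideanSpace ℝ (Fin 3)) :
    fderiv ℝ (crmCross a b r) z v =
      b * crmEquilibrium a b r 0 * (z 1 * v 2 + z 2 * v 1) := by
  have hcoord (i : Fin 3) := (EuclideanSpace.proj i : EuclideanSpace ℝ (Fin 3) →L[ℝ] ℝ).hasFDerivAt
    (x := z)
  have h := ((hcoord 1).mul (hcoord 2)).const_mul (b * crmEquilibrium a b r 0)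
  exact DFunLike.congr_fun h.fderiv v

theorem abs_crmCross_le (a b r : ℝ) (z : EuclideanSpace ℝ (Fin 3)) :
    |crmCross a b r z| ≤ |b * crmEquilibrium a b r 0| * ‖z - crmEquilibrium a b r‖ ^ 2 := by
  rw [crmCross, abs_mul, norm_sub_crmEquilibrium_sq]
  gcongr
  rw [abs_le]
  constructor <;>
    linarith [sq_nonneg (z 1 - z 2), sq_nonneg (z 1 + z 2),
      sq_nonneg (z 0 - crmEquilibrium a b r 0)]

theorem sq_add_sq_add_sq_le_of_mem_closedBall {R : ℝ} {z : EuclideanSpace ℝ (Fin 3)}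
    (hz : z ∈ closedBall (crmEquilibrium a b r) R) :
    (z 0 - crmEquilibrium a b r 0) ^ 2 + z 1 ^ 2 + z 2 ^ 2 ≤ R ^ 2 := by
  rw [← norm_sub_crmEquilibrium_sq]
  gcongr
  exact mem_closedBall_iff_norm.1 hz

theorem le_mul_crmField_one (γ ℓ : ℝ) {R : ℝ} {z : EuclideanSpace ℝ (Fin 3)}
    (hz : z ∈ closedBall (crmEquilibrium a b r) R) (t : ℝ) :
    (b * crmEquilibrium a b r 0) ^ 2 / 2 * z 2 ^ 2 - ((a + ℓ) ^ 2 + 2 * b ^ 2 * R ^ 2) *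
        ((z 0 - crmEquilibrium a b r 0) ^ 2 + z 1 ^ 2) ≤
      b * crmEquilibrium a b r 0 * z 2 * crmField a b γ r ℓ z t 1 := by
  have hR := sq_add_sq_add_sq_le_of_mem_closedBall hz
  have hfield : crmField a b γ r ℓ z t 1 = (a + ℓ) * z 1 + b * z 2 * (z 1 + z 0) := rfl
  rw [hfield]
  generalize crmEquilibrium a b r 0 = x at hR ⊢
  obtain ⟨ξ, hξ⟩ : ∃ ξ, z 0 = x + ξ := ⟨z 0 - x, (add_sub_cancel x (z 0)).symm⟩
  rw [hξ, add_sub_cancel_left] at hR ⊢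
  have hφ : z 2 ^ 2 ≤ R ^ 2 := by linarith [sq_nonneg ξ, sq_nonneg (z 1)]
  have hξe : (ξ + z 1) ^ 2 ≤ 2 * (ξ ^ 2 + z 1 ^ 2) := add_sq_le
  have young : -((b * x * z 2) ^ 2 / 2) -
      (((a + ℓ) * z 1) ^ 2 + (b * z 2 * (ξ + z 1)) ^ 2) ≤
      b * x * z 2 * ((a + ℓ) * z 1 + b * z 2 * (ξ + z 1)) := by
    linarith [sq_nonneg (b * x * z 2 + ((a + ℓ) * z 1 + b * z 2 * (ξ + z 1))),
      add_sq_le (a := (a + ℓ) * z 1) (b := b * z 2 * (ξ + z 1))]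
  calc (b * x) ^ 2 / 2 * z 2 ^ 2 - ((a + ℓ) ^ 2 + 2 * b ^ 2 * R ^ 2) * (ξ ^ 2 + z 1 ^ 2)
      = (b * x * z 2) ^ 2 / 2 - ((a + ℓ) ^ 2 * (ξ ^ 2 + z 1 ^ 2) +
          b ^ 2 * (R ^ 2 * (2 * (ξ ^ 2 + z 1 ^ 2)))) := by ring
    _ ≤ (b * x * z 2) ^ 2 / 2 -
          ((a + ℓ) ^ 2 * z 1 ^ 2 + b ^ 2 * (z 2 ^ 2 * (ξ + z 1) ^ 2)) := by
        gcongr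
        exact le_add_of_nonneg_left (sq_nonneg ξ)
    _ ≤ b * x * z 2 * ((a + ℓ) * z 1 + b * z 2 * (z 1 + (x + ξ))) := by
        linear_combination young

theorem le_mul_crmField_two (hbγ : 0 ≤ b * γ) (ℓ : ℝ) {R : ℝ} {z : EuclideanSpace ℝ (Fin 3)}
    (hz : z ∈ closedBall (crmEquilibrium a b r) R) (t : ℝ) :
    -(b * γ * (3 / 2 * crmEquilibrium a b r 0 ^ 2 + R ^ 2) *
        ((z 0 - crmEquilibrium a b r 0) ^ 2 + z 1 ^ 2)) ≤
      b * crmEquilibrium a b r 0 * z 1 * crmField a b γ r ℓ z t 2 := by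
  have hR := sq_add_sq_add_sq_le_of_mem_closedBall hz
  have hfield : crmField a b γ r ℓ z t 2 = -γ * z 1 * (z 1 + z 0) := rfl
  rw [hfield]
  generalize crmEquilibrium a b r 0 = x at hR ⊢
  have hx : x * (z 1 + z 0) ≤ 3 / 2 * x ^ 2 + R ^ 2 := by
    linarith [sq_nonneg (x - (z 0 - x + z 1)), add_sq_le (a := z 0 - x) (b := z 1),
      sq_nonneg (z 2)]
  have hle : b * γ * z 1 ^ 2 * (x * (z 1 + z 0)) ≤
      b * γ * ((z 0 - x) ^ 2 + z 1 ^ 2) * (3 / 2 * x ^ 2 + R ^ 2) :=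
    calc b * γ * z 1 ^ 2 * (x * (z 1 + z 0))
        ≤ b * γ * z 1 ^ 2 * (3 / 2 * x ^ 2 + R ^ 2) := by gcongr
      _ ≤ b * γ * ((z 0 - x) ^ 2 + z 1 ^ 2) * (3 / 2 * x ^ 2 + R ^ 2) := by
          gcongr
          exact le_add_of_nonneg_left (sq_nonneg _)
  linear_combination hle

theorem le_fderiv_crmCross_crmField (hbγ : 0 ≤ b * γ) (ℓ : ℝ) {R : ℝ}
    {z : EuclideanSpace ℝ (Fin 3)} (hz : z ∈ closedBall (crmEquilibrium a b r) R) (t : ℝ) :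
    (b * crmEquilibrium a b r 0) ^ 2 / 2 * ‖z - crmEquilibrium a b r‖ ^ 2 -
        ((b * crmEquilibrium a b r 0) ^ 2 / 2 + (a + ℓ) ^ 2 + 2 * b ^ 2 * R ^ 2 +
          b * γ * (3 / 2 * crmEquilibrium a b r 0 ^ 2 + R ^ 2)) *
        ((z 0 - crmEquilibrium a b r 0) ^ 2 + z 1 ^ 2) ≤
      fderiv ℝ (crmCross a b r) z (crmField a b γ r ℓ z t) := by
  rw [norm_sub_crmEquilibrium_sq, fderiv_crmCross_apply]
  linear_combination le_mul_crmField_one γ ℓ hz t + le_mul_crmField_two hbγ ℓ hz t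

theorem exists_strict_crmLyapunov (ha : a < 0) (haℓ : a + ℓ < 0) (hbγ : 0 < b * γ) (hr : r ≠ 0)
    (R : ℝ) :
    ∃ W, IsLyapunovCandidate W (crmEquilibrium a b r) ∧ ∃ κ > 0,
      ∀ t, 0 ≤ t → ∀ z ∈ closedBall (crmEquilibrium a b r) R,
        fderiv ℝ W z (crmField a b γ r ℓ z t) ≤ -κ * W z := by
  have hb : b ≠ 0 := left_ne_zero_of_mul hbγ.ne'
  have hγ : γ ≠ 0 := right_ne_zero_of_mul hbγ.ne'
  have hx := crmEquilibrium_zero_ne_zero ha.ne hb hr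
  have hd : 0 < -(a + ℓ) * a ^ 2 := mul_pos (neg_pos.2 haℓ) (sq_pos_of_neg ha)
  obtain ⟨W, hW, κ, hκ, hWf⟩ :=
    (isLyapunovCandidate_crmLyapunov ha haℓ hbγ r).exists_strict (differentiable_crmCross a b r)
      (abs_crmCross_le a b r) (by positivity) hd (fun z _ => by positivity)
      (fun z _ => fderiv_crmLyapunov_crmField_le ha.ne haℓ.le hγ b r z 0)
      (fun z hz => le_fderiv_crmCross_crmField hbγ.le ℓ hz 0)
  exact ⟨W, hW, κ, hκ, fun _ _ => hWf⟩

theorem exists_isTransitionFunction_crmField (ha : a < 0) (haℓ : a + ℓ < 0) (hbγ : 0 < b * γ)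
    (r : ℝ) : ∃ s, IsTransitionFunction (crmField a b γ r ℓ) s := by
  have hγ : γ ≠ 0 := right_ne_zero_of_mul hbγ.ne'
  have hV := isLyapunovCandidate_crmLyapunov ha haℓ hbγ r
  choose z hz₀ hz using fun t₀ x₀ => exists_isIntegralCurveOn_Ici_of_fderiv_nonpos
    (contDiff_crmField a b γ r ℓ 0) hV.differentiable
    (fun x => fderiv_crmLyapunov_crmField_nonpos ha.ne haℓ.le hγ b r x 0) hV.isBounded_sublevel
    t₀ x₀
  exact ⟨fun t x₀ t₀ => z t₀ x₀ t, fun t₀ _ x₀ => ⟨hz₀ t₀ x₀, hz t₀ x₀⟩⟩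

end CRM

end CRMStability

open CRMStability in
theorem mainTheorem8_general (a b γ r ℓ : ℝ) (ha : a < 0) (haℓ : a + ℓ < 0) (hbγ : 0 < b * γ)
    (hr : r ≠ 0) :
    (∀ p : EuclideanSpace ℝ (Fin 3),
      IsEquilibrium (crmField a b γ r ℓ) p ↔ p = crmEquilibrium a b r) ∧
    (∃ s : ℝ → EuclideanSpace ℝ (Fin 3) → ℝ → EuclideanSpace ℝ (Fin 3),
      IsTransitionFunction (crmField a b γ r ℓ) s) ∧
    (∀ s : ℝ → EuclideanSpace ℝ (Fin 3) → ℝ → EuclideanSpace ℝ (Fin 3),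
      IsTransitionFunction (crmField a b γ r ℓ) s → UASL s (crmEquilibrium a b r)) := by
  have hb : b ≠ 0 := left_ne_zero_of_mul hbγ.ne'
  have hγ : γ ≠ 0 := right_ne_zero_of_mul hbγ.ne'
  exact ⟨isEquilibrium_crmField_iff ha.ne haℓ.ne hb hγ hr,
    exists_isTransitionFunction_crmField ha haℓ hbγ r,
    fun _ hs => hs.uasl_of_lyapunov (isLyapunovCandidate_crmLyapunov ha haℓ hbγ r)
      (fun t _ z => fderiv_crmLyapunov_crmField_nonpos ha.ne haℓ.le hγ b r z t)
      (exists_strict_crmLyapunov ha haℓ hbγ hr)⟩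

theorem mainTheorem8 (a b γ r ℓ : ℝ) (ha : a < 0) (hb : 0 < b) (hγ : 0 < γ) (hℓ : ℓ < 0)
    (hr : r ≠ 0) :
    (∀ p : EuclideanSpace ℝ (Fin 3),
      CRMStability.IsEquilibrium (CRMStability.crmField a b γ r ℓ) p ↔
        p = CRMStability.crmEquilibrium a b r) ∧
    (∃ s : ℝ → EuclideanSpace ℝ (Fin 3) → ℝ → EuclideanSpace ℝ (Fin 3),
      CRMStability.IsTransitionFunction (CRMStability.crmField a b γ r ℓ) s) ∧
    (∀ s : ℝ → EuclideanSpace ℝ (Fin 3) → ℝ → EuclideanSpace ℝ (Fin 3),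
      CRMStability.IsTransitionFunction (CRMStability.crmField a b γ r ℓ) s →
        CRMStability.UASL s (CRMStability.crmEquilibrium a b r)) :=
  mainTheorem8_general a b γ r ℓ ha (by linarith) (mul_pos hb hγ) hr
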